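/- Consider budgeted causal bandits with $N\ge 1$ intervenable variables $X_1,\dots,X_N$ with values in $\{1,\dots,K\}$, $K\ge 2$, and a real reward $Y$. The causal graph $\mathcal G$ on $X_1,\dots,X_N,Y$ is an acyclic directed mixed graph, and the model $P$ is a structural causal model compatible with $\mathcal G$. The arms are $a_0$ (only observe) and $a_{i,x}$ (intervene by $do(X_i=x)$), with costs $c_a\ge 1$. An adaptive algorithm with budget $B\ge 0$ knows $\mathcal G$, the costs and $B$, but not $P$. In each round it chooses an arm, possibly at random, as a function of all previous arms and observations; then all variables are observed. The arm has to be affordable with the remaining budget, and the process stops when the remaining budget is smaller than the lowest cost. Write $\mu_a=\mathbb E[Y\mid a]$. The accumulated reward of an algorithm is $\mathbb E\big[\sum_{t\le T_B}\mu_{a^t}\big]$, where $a^t$ is the arm pulled in round $t$ and $T_B$ is the last round. The cumulative regret $R_c$ is the supremum of the accumulated rewards of all learners with budget $B$ in the same problem, minus that of the algorithm. There is an absolute constant $\kappa>0$ such that the following holds for all $N\ge1$, $K\ge 2$, $c\ge 1$, $c_0\in[1,c]$ and $B\ge0$. For every adaptive algorithm with budget $B$ there is a structural causal model $P$ on the parallel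 graph $\mathcal G_0$ (edges $X_i\to Y$ for all $i$, no hidden confounders) such that under every arm $a$ the reward is Gaussian with variance $1$ and mean $\mu_a$ satisfying $|\mu_a|\le\sqrt{KN/\lfloor B/c\rfloor}$ (read as $\mu_a=0$ if $B<c$), and such that, when every intervention costs $c$ and $a_0$ costs $c_0$ (in particular, for the uniform costs $c_0=c$), the cumulative regret of the algorithm satisfies $$R_c\ \ge\ \kappa\,\sqrt{\lfloor B/c\rfloor\,KN}.$$ -/

import Mathlib

open MeasureTheory ProbabilityTheory

noncomputable section

namespace CausalBandit

/-- The observed variables: `some i` is the intervenable variable `X_i`, `none` is the reward `Y`. -/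
abbrev Node (N : ℕ) : Type := Option (Fin N)

/-- Acyclic directed mixed graphs on the variables `X_1, …, X_N, Y`. A bidirected edge stands for
a hidden confounder of its two endpoints. -/
structure ADMG (N : ℕ) where
  /-- `dir v w`: there is a directed edge from `v` to `w`, that is, `v` is a parent of `w`. -/
  dir : Node N → Node N → Prop
  /-- `bidir v w`: there is a bidirected edge between `v` and `w`. -/
  bidir : Node N → Node N → Prop
  bidir_symm : ∀ v w, bidir v w → bidir w v
  bidir_irrefl : ∀ v, ¬ bidir v v
  acyclic : ∀ v, ¬ Relation.TransGen dir v v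

/-- The parallel graph: its edges are `X_i → Y` for all `i`, and there are no confounders. -/
def parallelGraph (N : ℕ) : ADMG N where
  dir v w := v ≠ none ∧ w = none
  bidir _ _ := False
  bidir_symm _ _ h := h
  bidir_irrefl _ h := h
  acyclic v h := by
    have h1 : ∀ a b : Node N, Relation.TransGen (fun v w : Node N => v ≠ none ∧ w = none) a b →
        a ≠ none ∧ b = none := by
      intro a b hab
      induction hab with
      | single h => exact h
      | tail _ h ih => exact ⟨ih.1, h.2⟩
    exact (h1 v v h).1 (h1 v v h).2

/-- Values of all observed variables: `X_1, …, X_N` in a domain of size `K`, and a real reward. -/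
abbrev Config (N K : ℕ) : Type := (Fin N → Fin K) × ℝ

/-- The two configurations give the same value to the variable `v`. -/
def AgreeAt {N K : ℕ} (z z' : Config N K) : Node N → Prop
  | none => z.2 = z'.2
  | some i => z.1 i = z'.1 i

/-- Values of the exogenous variables. The coordinate `s(v, v)` is the private noise of `v`, the
coordinate `s(v, w)` with `v ≠ w` is the potential hidden confounder of `v` and `w`. -/
abbrev Latent (N : ℕ) : Type := Sym2 (Node N) → ℝ

/-- Arms: `none` is `a_0` (only observe), `some (i, x)` is the intervention `do(X_i = x)`. -/
abbrev Arm (N K : ℕ) : Type := Option (Fin N × Fin K)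

instance (N K : ℕ) : MeasurableSpace (Arm N K) := ⊤

instance (N K : ℕ) : DiscreteMeasurableSpace (Arm N K) := ⟨fun _ => trivial⟩

/-- Structural causal models compatible with the graph `G`: the exogenous variables are independent,
and each observed variable is a function of its parents, its private noise and the hidden
confounders on the bidirected edges at it. -/
structure SCM {N : ℕ} (G : ADMG N) (K : ℕ) where
  noise : Sym2 (Node N) → Measure ℝ
  noise_prob : ∀ e, IsProbabilityMeasure (noise e)
  /-- The right-hand sides of the structural equations, for all observed variables at once. -/
  mech : Config N K → Latent N → Config N K
  measurable_mech : Measurable (Function.uncurry mech)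
  mech_compat : ∀ (v : Node N) (z z' : Config N K) (u u' : Latent N),
    (∀ w, G.dir w v → AgreeAt z z' w) → u s(v, v) = u' s(v, v) →
    (∀ w, G.bidir v w → u s(v, w) = u' s(v, w)) →
    AgreeAt (mech z u) (mech z' u') v

namespace SCM

variable {N K : ℕ} {G : ADMG N}

/-- The structural equations after the action `a`: under `do(X_i = x)` the equation of `X_i`
is replaced by `X_i = x`. -/
def doMech (M : SCM G K) (a : Arm N K) (z : Config N K) (u : Latent N) : Config N K :=
  match a with
  | none => M.mech z u
  | some (i, x) => (Function.update (M.mech z u).1 i x, (M.mech z u).2)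

/-- The solution of the structural equations after the action `a`. The graph is acyclic and has
`N + 1` nodes, so iterating the equations `N + 1` times solves them; see `solve_spec` and
`solve_unique`. -/
def solve [NeZero K] (M : SCM G K) (a : Arm N K) (u : Latent N) : Config N K :=
  (fun z => M.doMech a z u)^[N + 1] (fun _ => 0, 0)

theorem doMech_compat (M : SCM G K) (a : Arm N K) (v : Node N) (z z' : Config N K) (u : Latent N)
    (h : ∀ w, G.dir w v → AgreeAt z z' w) : AgreeAt (M.doMech a z u) (M.doMech a z' u) v := by
  have h1 := M.mech_compat v z z' u u h rfl (fun _ _ => rfl)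
  rcases a with _ | ⟨i, x⟩
  · exact h1
  · rcases v with _ | j
    · exact h1
    · simp only [doMech, AgreeAt] at h1 ⊢
      by_cases hj : j = i
      · subst hj; simp
      · simpa [Function.update_of_ne hj] using h1

open Classical in
theorem iterate_agree (M : SCM G K) (a : Arm N K) (u : Latent N) (z z' : Config N K) :
    (fun z => M.doMech a z u)^[N + 1] z = (fun z => M.doMech a z u)^[N + 1] z' := by
  let anc : Node N → Finset (Node N) :=
    fun v => Finset.univ.filter (fun w => Relation.TransGen G.dir w v)
  have key : ∀ (n : ℕ) (v : Node N), (anc v).card < n →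
      AgreeAt ((fun z => M.doMech a z u)^[n] z) ((fun z => M.doMech a z u)^[n] z') v := by
    intro n
    induction n with
    | zero => intro v hv; exact absurd hv (Nat.not_lt_zero _)
    | succ n ih =>
      intro v hv
      rw [Function.iterate_succ_apply', Function.iterate_succ_apply']
      refine M.doMech_compat a v _ _ u (fun w hw => ih w ?_)
      have hss : anc w ⊂ anc v := by
        refine Finset.ssubset_iff_subset_ne.2 ⟨?_, ?_⟩
        · intro y hy
          simp only [anc, Finset.mem_filter, Finset.mem_univ, true_and] at hy ⊢
          exact hy.tail hw
        · intro he
          have hm : w ∈ anc v := by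
            simpa [anc] using Relation.TransGen.single hw
          rw [← he] at hm
          simp only [anc, Finset.mem_filter, Finset.mem_univ, true_and] at hm
          exact G.acyclic w hm
      have := Finset.card_lt_card hss
      omega
  have hall : ∀ v : Node N, (anc v).card < N + 1 := by
    intro v
    have h1 : anc v ⊂ Finset.univ := by
      refine Finset.ssubset_univ_iff.2 (fun he => ?_)
      have hm : v ∈ anc v := by rw [he]; exact Finset.mem_univ v
      simp only [anc, Finset.mem_filter, Finset.mem_univ, true_and] at hm
      exact G.acyclic v hm
    have := Finset.card_lt_card h1
    simpa using this
  refine Prod.ext (funext fun i => ?_) ?_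
  · exact key (N + 1) (some i) (hall _)
  · exact key (N + 1) none (hall _)

theorem solve_spec [NeZero K] (M : SCM G K) (a : Arm N K) (u : Latent N) :
    M.doMech a (M.solve a u) u = M.solve a u := by
  unfold solve
  rw [← Function.iterate_succ_apply' (fun z => M.doMech a z u), Function.iterate_succ_apply]
  exact M.iterate_agree a u _ _

theorem solve_unique [NeZero K] (M : SCM G K) (a : Arm N K) (u : Latent N) (z : Config N K)
    (hz : M.doMech a z u = z) : z = M.solve a u := by
  have h : (fun z => M.doMech a z u)^[N + 1] z = z := Function.iterate_fixed hz _
  rw [← h]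
  exact M.iterate_agree a u _ _

theorem measurable_doMech (M : SCM G K) (a : Arm N K) :
    Measurable (Function.uncurry (M.doMech a)) := by
  have h := M.measurable_mech
  rcases a with _ | ⟨i, x⟩
  · exact h
  · refine Measurable.prodMk (measurable_pi_lambda _ fun j => ?_) h.snd
    by_cases hj : j = i
    · subst hj
      simp [Function.update_self]
    · simp only [Function.update_of_ne hj]
      exact (measurable_pi_apply j).comp h.fst

theorem measurable_solve [NeZero K] (M : SCM G K) (a : Arm N K) : Measurable (M.solve a) := by
  have h : ∀ n : ℕ, Measurable
      (fun u : Latent N => (fun z => M.doMech a z u)^[n] ((fun _ => 0, 0) : Config N K)) := by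
    intro n
    induction n with
    | zero => exact measurable_const
    | succ n ih =>
      simp only [Function.iterate_succ_apply']
      exact (M.measurable_doMech a).comp (ih.prodMk measurable_id)
  exact h (N + 1)

/-- The joint distribution of all observed variables under the action `a`: the observational
distribution for `a_0`, the post-interventional distribution for `do(X_i = x)`. -/
def law [NeZero K] (M : SCM G K) (a : Arm N K) : Measure (Config N K) :=
  (Measure.pi M.noise).map (M.solve a)

instance [NeZero K] (M : SCM G K) (a : Arm N K) : IsProbabilityMeasure (M.law a) := by
  have := M.noise_prob
  exact Measure.isProbabilityMeasure_map (M.measurable_solve a).aemeasurable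

/-- The distribution of the reward under the action `a`. -/
def rewardLaw [NeZero K] (M : SCM G K) (a : Arm N K) : Measure ℝ :=
  (M.law a).map Prod.snd

/-- The expected reward `μ_a = E[Y | a]`. -/
def mean [NeZero K] (M : SCM G K) (a : Arm N K) : ℝ := ∫ y, y ∂(M.rewardLaw a)

/-- The response of the environment to an arm: all observed variables are sampled. -/
def env [NeZero K] (M : SCM G K) : Kernel (Arm N K) (Config N K) :=
  ⟨M.law, Measurable.of_discrete⟩

instance [NeZero K] (M : SCM G K) : IsMarkovKernel M.env :=
  ⟨fun a => inferInstanceAs (IsProbabilityMeasure (M.law a))⟩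

end SCM

/-- Histories of `t` rounds: in each round an arm is pulled and the variables are observed. -/
def Hist (N K : ℕ) : ℕ → Type
  | 0 => Unit
  | t + 1 => Hist N K t × (Arm N K × Config N K)

/-- The product σ-algebra on histories. -/
instance histMeasurableSpace (N K : ℕ) : (t : ℕ) → MeasurableSpace (Hist N K t)
  | 0 => inferInstanceAs (MeasurableSpace Unit)
  | t + 1 => @Prod.instMeasurableSpace _ _ (histMeasurableSpace N K t) inferInstance

/-- The total cost of the arms pulled in a history. -/
def spent {N K : ℕ} (cost : Arm N K → ℝ) : (t : ℕ) → Hist N K t → ℝ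
  | 0, _ => 0
  | t + 1, (h, s) => spent cost t h + cost s.1

/-- The lowest cost of an arm. -/
def minCost {N K : ℕ} (cost : Arm N K → ℝ) : ℝ := ⨅ a, cost a

/-- After the history `h`, the remaining part of the budget `B` pays at least for the cheapest
arm. -/
def Active {N K : ℕ} (cost : Arm N K → ℝ) (B : ℝ) (t : ℕ) (h : Hist N K t) : Prop :=
  spent cost t h + minCost cost ≤ B

/-- Adaptive (possibly randomized) learners with budget `B`: the next arm depends on the whole
history, and it has to be affordable as long as some arm is. What the policy does afterwards has
no effect on the accumulated reward. -/
structure Learner {N K : ℕ} (cost : Arm N K → ℝ) (B : ℝ) where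
  policy : (t : ℕ) → Kernel (Hist N K t) (Arm N K)
  policy_markov : ∀ t, IsMarkovKernel (policy t)
  affordable : ∀ (t : ℕ) (h : Hist N K t), Active cost B t h →
    ∀ᵐ a ∂(policy t h), spent cost t h + cost a ≤ B

section Regret

variable {N K : ℕ} [NeZero K] {G : ADMG N} {cost : Arm N K → ℝ} {B : ℝ}

/-- The distribution of the history of the first `t` rounds when the learner `L` interacts with the
model `M`: in each round the arm is drawn from the policy, then the variables are drawn under
this arm. -/
def histLaw (M : SCM G K) (L : Learner cost B) : (t : ℕ) → Measure (Hist N K t)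
  | 0 => (Measure.dirac () : Measure Unit)
  | t + 1 => (histLaw M L t) ⊗ₘ (L.policy t ⊗ₖ Kernel.prodMkLeft (Hist N K t) M.env)

open Classical in
/-- The sum of the expected rewards `μ_{a^t}` of the arms pulled along a history until the budget
is consumed. -/
def accumulated (M : SCM G K) (cost : Arm N K → ℝ) (B : ℝ) : (t : ℕ) → Hist N K t → ℝ
  | 0, _ => 0
  | t + 1, (h, s) =>
      accumulated M cost B t h + if Active cost B t h then M.mean s.1 else 0

/-- The expected reward accumulated by the learner until its budget is consumed. At most
`⌊B / minCost⌋` rounds can be played, see `not_active_of_le`. -/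
def expectedReward (M : SCM G K) (L : Learner cost B) : ℝ :=
  ∫ h, accumulated M cost B ⌊B / minCost cost⌋₊ h ∂(histLaw M L ⌊B / minCost cost⌋₊)

/-- The expected reward accumulated by the optimum learner with budget `B`. -/
def optimalReward (M : SCM G K) (cost : Arm N K → ℝ) (B : ℝ) : ℝ :=
  ⨆ L : Learner cost B, expectedReward M L

/-- The (expected) cumulative regret of a learner with budget `B`. -/
def cumulativeRegret (M : SCM G K) (L : Learner cost B) : ℝ :=
  optimalReward M cost B - expectedReward M L

end Regret

section Facts

variable {N K : ℕ} {cost : Arm N K → ℝ} {B : ℝ}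

theorem minCost_le (cost : Arm N K → ℝ) (a : Arm N K) : minCost cost ≤ cost a :=
  ciInf_le (Set.finite_range cost).bddBelow a

theorem one_le_minCost (hcost : ∀ a, 1 ≤ cost a) : 1 ≤ minCost cost := le_ciInf hcost

theorem mul_minCost_le_spent (t : ℕ) (h : Hist N K t) : t * minCost cost ≤ spent cost t h := by
  induction t with
  | zero => simp [spent]
  | succ t ih =>
    obtain ⟨h, s⟩ := h
    have h1 := ih h
    have h2 := minCost_le cost s.1
    simp only [spent]
    push_cast
    linarith

theorem not_active_of_le (hcost : ∀ a, 1 ≤ cost a) {t : ℕ} (ht : ⌊B / minCost cost⌋₊ ≤ t)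
    (h : Hist N K t) : ¬ Active cost B t h := by
  intro hact
  have hpos : 0 < minCost cost := lt_of_lt_of_le one_pos (one_le_minCost hcost)
  have h1 := mul_minCost_le_spent (cost := cost) t h
  have h2 : ((t + 1 : ℕ) : ℝ) ≤ B / minCost cost := by
    rw [le_div_iff₀ hpos]
    unfold Active at hact
    push_cast
    linarith
  have h3 := Nat.le_floor h2
  omega

instance [NeZero K] {G : ADMG N} (M : SCM G K) (L : Learner cost B) (t : ℕ) :
    IsProbabilityMeasure (histLaw M L t) := by
  induction t with
  | zero => exact inferInstanceAs (IsProbabilityMeasure (Measure.dirac ()))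
  | succ t ih =>
    have := L.policy_markov t
    exact inferInstanceAs (IsProbabilityMeasure
      ((histLaw M L t) ⊗ₘ (L.policy t ⊗ₖ Kernel.prodMkLeft (Hist N K t) M.env)))

/-- The supremum in `optimalReward` is over a bounded set. -/
theorem bddAbove_expectedReward [NeZero K] {G : ADMG N} (M : SCM G K) (cost : Arm N K → ℝ) (B : ℝ) :
    BddAbove (Set.range fun L : Learner cost B => expectedReward M L) := by
  have hsum : ∀ a, |M.mean a| ≤ ∑ b, |M.mean b| := fun a =>
    Finset.single_le_sum (f := fun b => |M.mean b|) (fun b _ => abs_nonneg _) (Finset.mem_univ a)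
  have hb : ∀ (t : ℕ) (h : Hist N K t),
      ‖accumulated M cost B t h‖ ≤ t * ∑ b, |M.mean b| := by
    intro t
    induction t with
    | zero => intro h; simp [accumulated]
    | succ t ih =>
      rintro ⟨h, s⟩
      have h1 := ih h
      have h2 := hsum s.1
      have h3 : (0 : ℝ) ≤ ∑ b, |M.mean b| := Finset.sum_nonneg fun b _ => abs_nonneg _
      simp only [accumulated, Real.norm_eq_abs] at h1 ⊢
      refine (abs_add_le _ _).trans ?_
      push_cast
      split_ifs
      · linarith
      · simp only [abs_zero]; linarith
  refine ⟨⌊B / minCost cost⌋₊ * ∑ b, |M.mean b|, ?_⟩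
  rintro _ ⟨L, rfl⟩
  have h := norm_integral_le_of_norm_le_const (μ := histLaw M L ⌊B / minCost cost⌋₊)
    (Filter.Eventually.of_forall (hb ⌊B / minCost cost⌋₊))
  rw [probReal_univ, mul_one] at h
  exact (le_abs_self _).trans h

end Facts

/-- Algorithms for causal bandits with `N` intervenable variables of domain size `K` and budget `B`:
they receive the causal graph and the costs (all at least one), but not the model. -/
abbrev Algorithm (N K : ℕ) (B : ℝ) : Type :=
  ADMG N → (cost : Arm N K → ℝ) → (∀ a, 1 ≤ cost a) → Learner cost B

/-- Observing costs `c₀`, every intervention costs `c`. -/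
def armCost {N K : ℕ} (c₀ c : ℝ) : Arm N K → ℝ
  | none => c₀
  | some _ => c

theorem one_le_armCost {N K : ℕ} {c₀ c : ℝ} (h₀ : 1 ≤ c₀) (hc : c₀ ≤ c) (a : Arm N K) :
    1 ≤ armCost c₀ c a := by
  rcases a with _ | p
  · exact h₀
  · exact h₀.trans hc

end CausalBandit

end

open scoped ENNReal

noncomputable section

namespace CausalBandit

/-! ### Models on the parallel graph with deterministic covariates and additive Gaussian reward -/

section Model

variable {N K : ℕ} [NeZero K]

/-! This is a two-model argument. All covariates default to `0`, so only the reward carries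
information, and `a_0` and every `do(X_i = 0)` have mean `0`. In the null model every other
intervention has mean `-δ`; in the flipped model one of them, `q`, has mean `δ` instead. Put `n = ⌊B
/ c⌋₊`, `R = √(KN / n)` and `δ = R / 32`.

If the learner makes at least `n / 2` such pulls on average in the null model, it loses `δ n / 2`
against a learner earning `0`. Otherwise one of the `m = N (K - 1) ≥ KN / 2` interventions, taken as
`q`, has fewer than `n / (2 m)` expected pulls. The relative entropy between the two models is `2
δ²` per pull of `q`, so the learner hardly notices the flip and pulls `q` at most `3 n / 4` times on
average in the flipped model (`integral_pulls_flip_le`). Repeating `q` earns `δ n`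
(`le_optimalReward`), which leaves a regret of `δ n / 4`.

Observing may be much cheaper than `c`, so the number of rounds can far exceed `n`. It plays no
role: pulls of `q` are capped by `n` through the budget (`mul_pulls_le`), and the information
depends only on these pulls. The change of measure (`lintegral_pulls_flip`) is restricted to rounds
before the budget is consumed. The step from likelihood ratios to pull counts uses
`abs_exp_sub_one_le` and Wald's identity `integral_armYield`. -/

/-- Without intervention every `X_i` is `0`, and `Y = ∑ i, θ (i, X_i) + ε` with a standard Gaussian
noise `ε`. -/
def additiveSCM (θ : Fin N × Fin K → ℝ) : SCM (parallelGraph N) K where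
  noise _ := gaussianReal 0 1
  noise_prob _ := inferInstance
  mech z u := (fun _ => 0, ∑ i, θ (i, z.1 i) + u s(none, none))
  measurable_mech := by
    refine Measurable.prodMk measurable_const (Measurable.add ?_ ?_)
    · exact (Measurable.of_discrete (f := fun x : Fin N → Fin K => ∑ i, θ (i, x i))).comp
        measurable_fst.fst
    · exact (measurable_pi_apply _).comp measurable_snd
  mech_compat v z z' u u' h hu _ := by
    rcases v with _ | i
    · have h1 : z.1 = z'.1 := funext fun i => h (some i) ⟨by simp, rfl⟩
      simp only [AgreeAt, h1, hu]
    · rfl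

/-- The values of the covariates under an arm when they are `0` by default. -/
def armPoint : Arm N K → Fin N → Fin K
  | none => fun _ => 0
  | some (i, x) => Function.update (fun _ => 0) i x

/-- The mean reward of an arm in the additive model. -/
def armMean (θ : Fin N × Fin K → ℝ) : Arm N K → ℝ
  | none => 0
  | some p => θ p

variable {θ : Fin N × Fin K → ℝ}

theorem sum_armPoint (hθ : ∀ i, θ (i, 0) = 0) (a : Arm N K) :
    ∑ i, θ (i, armPoint a i) = armMean θ a := by
  rcases a with _ | ⟨i, x⟩
  · simp [armPoint, armMean, hθ]
  · rw [Finset.sum_eq_single i]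
    · simp [armPoint, armMean]
    · intro j _ hj
      simp [armPoint, Function.update_of_ne hj, hθ]
    · simp

theorem solve_additiveSCM (hθ : ∀ i, θ (i, 0) = 0) (a : Arm N K) (u : Latent N) :
    (additiveSCM θ).solve a u = (armPoint a, armMean θ a + u s(none, none)) := by
  refine ((additiveSCM θ).solve_unique a u _ ?_).symm
  rw [← sum_armPoint hθ]
  rcases a with _ | ⟨i, x⟩ <;> rfl

theorem law_additiveSCM (hθ : ∀ i, θ (i, 0) = 0) (a : Arm N K) :
    (additiveSCM θ).law a =
      (gaussianReal (armMean θ a) 1).map (fun y => (armPoint a, y)) := by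
  have h1 : (additiveSCM θ).solve a =
      (fun y : ℝ => (armPoint a, y)) ∘ (fun y => armMean θ a + y) ∘
        (Function.eval s(none, none) : Latent N → ℝ) :=
    funext fun u => solve_additiveSCM hθ a u
  have h2 : (Measure.pi (fun _ : Sym2 (Node N) => gaussianReal 0 1)).map
      (Function.eval s(none, none)) = gaussianReal 0 1 :=
    (measurePreserving_eval (fun _ : Sym2 (Node N) => gaussianReal 0 1) s(none, none)).map_eq
  have h3 : Measurable (Function.eval s(none, none) : Latent N → ℝ) := measurable_pi_apply _
  have h4 : Measurable (fun y : ℝ => armMean θ a + y) := measurable_const.add measurable_id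
  have h5 : Measurable (fun y : ℝ => (armPoint a, y)) := measurable_const.prodMk measurable_id
  unfold SCM.law
  rw [h1, ← Measure.map_map h5 (h4.comp h3), ← Measure.map_map h4 h3]
  change (((Measure.pi (fun _ : Sym2 (Node N) => gaussianReal 0 1)).map _).map _).map _ = _
  rw [h2, gaussianReal_map_const_add, zero_add]

theorem rewardLaw_additiveSCM (hθ : ∀ i, θ (i, 0) = 0) (a : Arm N K) :
    (additiveSCM θ).rewardLaw a = gaussianReal (armMean θ a) 1 := by
  unfold SCM.rewardLaw
  rw [law_additiveSCM hθ, Measure.map_map measurable_snd measurable_prodMk_left]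
  exact Measure.map_id

theorem mean_additiveSCM (hθ : ∀ i, θ (i, 0) = 0) (a : Arm N K) :
    (additiveSCM θ).mean a = armMean θ a := by
  unfold SCM.mean
  rw [rewardLaw_additiveSCM hθ, integral_id_gaussianReal]

theorem lintegral_law_additiveSCM (hθ : ∀ i, θ (i, 0) = 0) (a : Arm N K)
    {f : Config N K → ℝ≥0∞} (hf : Measurable f) :
    ∫⁻ z, f z ∂(additiveSCM θ).law a =
      ∫⁻ y, f (armPoint a, y) ∂gaussianReal (armMean θ a) 1 := by
  rw [law_additiveSCM hθ, lintegral_map hf measurable_prodMk_left]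

/-- The quadratic terms of the two exponents cancel: `((y + δ)² - (y - δ)²) / 2 = 2 δ y`. With means
symmetric about `0` no constant remains, so the log-likelihood ratio of a history is a multiple of
the total reward of the flipped arm. -/
theorem lintegral_gaussianReal_neg {δ : ℝ} {f : ℝ → ℝ≥0∞} (hf : Measurable f) :
    ∫⁻ y, f y ∂gaussianReal δ 1 =
      ∫⁻ y, ENNReal.ofReal (Real.exp (2 * δ * y)) * f y ∂gaussianReal (-δ) 1 := by
  rw [gaussianReal_of_var_ne_zero _ one_ne_zero, gaussianReal_of_var_ne_zero _ one_ne_zero,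
    lintegral_withDensity_eq_lintegral_mul _ (measurable_gaussianPDF _ _) hf,
    lintegral_withDensity_eq_lintegral_mul _ (measurable_gaussianPDF _ _) (by fun_prop)]
  refine lintegral_congr fun y => ?_
  simp only [Pi.mul_apply, ← mul_assoc]
  congr 1
  rw [gaussianPDF, gaussianPDF, ← ENNReal.ofReal_mul (gaussianPDFReal_nonneg _ _ _),
    gaussianPDFReal, gaussianPDFReal, mul_assoc _ (Real.exp _) (Real.exp _), ← Real.exp_add]
  congr 3
  simp only [NNReal.coe_one]
  ring

/-- The density of the reward of the arm `a` when the mean of the arm `b` is raised from `-δ`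
to `δ`. -/
def flipDensity (δ : ℝ) (b a : Arm N K) (z : Config N K) : ℝ≥0∞ :=
  ENNReal.ofReal (Real.exp (2 * δ * if a = b then z.2 else 0))

/-- The covariates are a fixed function of the arm in both models, so the density comes from the
reward alone and is `1` for every arm other than `b`. -/
theorem lintegral_law_flip {θ θ' : Fin N × Fin K → ℝ} (hθ : ∀ i, θ (i, 0) = 0)
    (hθ' : ∀ i, θ' (i, 0) = 0) {b : Arm N K} {δ : ℝ} (hb : armMean θ b = -δ)
    (hb' : armMean θ' b = δ) (hne : ∀ a, a ≠ b → armMean θ' a = armMean θ a) (a : Arm N K)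
    {f : Config N K → ℝ≥0∞} (hf : Measurable f) :
    ∫⁻ z, f z ∂(additiveSCM θ').law a =
      ∫⁻ z, flipDensity δ b a z * f z ∂(additiveSCM θ).law a := by
  have hm : Measurable fun z => flipDensity δ b a z * f z := by
    unfold flipDensity
    by_cases h : a = b <;> simp only [h, if_true, if_false] <;> fun_prop
  rw [lintegral_law_additiveSCM hθ' a hf, lintegral_law_additiveSCM hθ a hm]
  by_cases h : a = b
  · subst h
    simp only [flipDensity, if_true]
    rw [hb, hb']
    exact lintegral_gaussianReal_neg (hf.comp measurable_prodMk_left)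
  · simp [flipDensity, h, hne a h]

theorem integrable_snd_law (hθ : ∀ i, θ (i, 0) = 0) (a : Arm N K) :
    Integrable (fun z : Config N K => z.2) ((additiveSCM θ).law a) := by
  rw [law_additiveSCM hθ, integrable_map_measure measurable_snd.aestronglyMeasurable
    measurable_prodMk_left.aemeasurable]
  exact memLp_one_iff_integrable.1 (by simpa using memLp_id_gaussianReal (μ := armMean θ a) (v := 1) 1)

end Model

theorem SCM.integral_snd_law {N K : ℕ} [NeZero K] {G : ADMG N} (M : SCM G K) (a : Arm N K) :
    ∫ z, z.2 ∂M.law a = M.mean a := by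
  unfold SCM.mean SCM.rewardLaw
  exact (integral_map measurable_snd.aemeasurable measurable_id.aestronglyMeasurable).symm

/-! ### Histories -/

section History

variable {N K : ℕ} {cost : Arm N K → ℝ} {B : ℝ}

theorem measurable_spent (cost : Arm N K → ℝ) : ∀ t, Measurable (spent cost t)
  | 0 => measurable_const
  | t + 1 => by
    have h1 : Measurable fun q : Hist N K t × (Arm N K × Config N K) => spent cost t q.1 :=
      (measurable_spent cost t).comp measurable_fst
    have h2 : Measurable fun q : Hist N K t × (Arm N K × Config N K) => cost q.2.1 :=
      (Measurable.of_discrete (f := cost)).comp measurable_snd.fst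
    exact h1.add h2

theorem measurableSet_active (cost : Arm N K → ℝ) (B : ℝ) (t : ℕ) :
    MeasurableSet {h : Hist N K t | Active cost B t h} :=
  measurableSet_le ((measurable_spent cost t).add_const _) measurable_const

theorem measurableSet_active_and (cost : Arm N K → ℝ) (B : ℝ) (t : ℕ) (S : Set (Arm N K)) :
    MeasurableSet {q : Hist N K t × (Arm N K × Config N K) |
      Active cost B t q.1 ∧ q.2.1 ∈ S} :=
  (measurable_fst (measurableSet_active cost B t)).inter
    (measurable_snd.fst (MeasurableSet.of_discrete (s := S)))

open Classical in
/-- The number of pulls of arms in `S` until the budget is consumed. -/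
def pulls (cost : Arm N K → ℝ) (B : ℝ) (S : Set (Arm N K)) : (t : ℕ) → Hist N K t → ℕ
  | 0, _ => 0
  | t + 1, (h, s) => pulls cost B S t h + if Active cost B t h ∧ s.1 ∈ S then 1 else 0

open Classical in
/-- The sum of the observed rewards of the pulls of `b` until the budget is consumed. -/
def armYield (cost : Arm N K → ℝ) (B : ℝ) (b : Arm N K) : (t : ℕ) → Hist N K t → ℝ
  | 0, _ => 0
  | t + 1, (h, s) => armYield cost B b t h + if Active cost B t h ∧ s.1 = b then s.2.2 else 0

theorem measurable_pulls (cost : Arm N K → ℝ) (B : ℝ) (S : Set (Arm N K)) :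
    ∀ t, Measurable (pulls cost B S t)
  | 0 => measurable_const
  | t + 1 => by
    classical
    have h1 : Measurable fun q : Hist N K t × (Arm N K × Config N K) => pulls cost B S t q.1 :=
      (measurable_pulls cost B S t).comp measurable_fst
    have h2 : Measurable fun q : Hist N K t × (Arm N K × Config N K) =>
        if Active cost B t q.1 ∧ q.2.1 ∈ S then 1 else 0 :=
      Measurable.ite (measurableSet_active_and cost B t S) measurable_const measurable_const
    exact h1.add h2

open Classical in
theorem measurable_armYield_step (cost : Arm N K → ℝ) (B : ℝ) (b : Arm N K) (t : ℕ) :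
    Measurable fun q : Hist N K t × (Arm N K × Config N K) =>
      if Active cost B t q.1 ∧ q.2.1 = b then q.2.2.2 else 0 :=
  Measurable.ite (measurableSet_active_and cost B t {b}) measurable_snd.snd.snd measurable_const

theorem measurable_armYield (cost : Arm N K → ℝ) (B : ℝ) (b : Arm N K) :
    ∀ t, Measurable (armYield cost B b t)
  | 0 => measurable_const
  | t + 1 => by
    classical
    have h1 : Measurable fun q : Hist N K t × (Arm N K × Config N K) => armYield cost B b t q.1 :=
      (measurable_armYield cost B b t).comp measurable_fst
    exact h1.add (measurable_armYield_step cost B b t)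

theorem pulls_le (cost : Arm N K → ℝ) (B : ℝ) (S : Set (Arm N K)) (t : ℕ) (h : Hist N K t) :
    pulls cost B S t h ≤ t := by
  induction t with
  | zero => exact le_rfl
  | succ t ih =>
    obtain ⟨h, s⟩ := h
    have := ih h
    simp only [pulls]
    split_ifs <;> omega

open Classical in
/-- The arm `b` while it is affordable, and `a_0` afterwards. -/
def repeatArm (cost : Arm N K → ℝ) (B : ℝ) (b : Arm N K) (t : ℕ) (h : Hist N K t) : Arm N K :=
  if spent cost t h + cost b ≤ B then b else none

theorem measurable_repeatArm (b : Arm N K) (t : ℕ) : Measurable (repeatArm cost B b t) := by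
  classical
  exact Measurable.ite (measurableSet_le ((measurable_spent cost t).add_const _) measurable_const)
    measurable_const measurable_const

/-- The joint distribution of the next arm and the next observation. -/
def stepKernel [NeZero K] {G : ADMG N} (M : SCM G K) (L : Learner cost B) (t : ℕ) :
    Kernel (Hist N K t) (Arm N K × Config N K) :=
  L.policy t ⊗ₖ Kernel.prodMkLeft (Hist N K t) M.env

variable [NeZero K] {G : ADMG N} (M : SCM G K) (L : Learner cost B)

instance (t : ℕ) : IsMarkovKernel (L.policy t) := L.policy_markov t

instance (t : ℕ) : IsMarkovKernel (stepKernel M L t) :=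
  inferInstanceAs (IsMarkovKernel (L.policy t ⊗ₖ Kernel.prodMkLeft (Hist N K t) M.env))

theorem lintegral_stepKernel (t : ℕ) (h : Hist N K t) {f : Arm N K × Config N K → ℝ≥0∞}
    (hf : Measurable f) :
    ∫⁻ s, f s ∂stepKernel M L t h = ∫⁻ a, ∫⁻ z, f (a, z) ∂M.law a ∂L.policy t h := by
  unfold stepKernel
  rw [Kernel.lintegral_compProd _ _ _ hf]
  rfl

theorem lintegral_histLaw_succ (t : ℕ) {f : Hist N K (t + 1) → ℝ≥0∞} (hf : Measurable f) :
    ∫⁻ q, f q ∂histLaw M L (t + 1) =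
      ∫⁻ h, ∫⁻ s, f (h, s) ∂stepKernel M L t h ∂histLaw M L t :=
  Measure.lintegral_compProd (μ := histLaw M L t) (κ := stepKernel M L t) hf

theorem ae_histLaw_succ (t : ℕ) {p : Hist N K (t + 1) → Prop} (hp : MeasurableSet {q | p q})
    (h : ∀ᵐ h ∂histLaw M L t, ∀ᵐ a ∂L.policy t h, ∀ z, p (h, (a, z))) :
    ∀ᵐ q ∂histLaw M L (t + 1), p q := by
  refine Measure.ae_compProd_of_ae_ae (μ := histLaw M L t) (κ := stepKernel M L t) hp ?_
  filter_upwards [h] with h hh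
  refine Kernel.ae_compProd_of_ae_ae (measurable_prodMk_left (x := h) hp) ?_
  filter_upwards [hh] with a ha
  exact Filter.Eventually.of_forall ha

/-- Pulls of arms of cost at least `c` are limited by the budget. -/
theorem mul_pulls_le (hcost : ∀ a, 0 ≤ cost a) (hB : 0 ≤ B) {S : Set (Arm N K)} {c : ℝ}
    (hS : ∀ a ∈ S, cost a = c) (t : ℕ) :
    ∀ᵐ h ∂histLaw M L t, c * pulls cost B S t h ≤ B := by
  classical
  -- This holds for every history but does not suffice, since `spent` may exceed `B` after the
  -- budget is consumed. The bound by `B` comes from affordability at the last counted pull.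
  have hle : ∀ (t : ℕ) (h : Hist N K t), c * pulls cost B S t h ≤ spent cost t h := by
    intro t
    induction t with
    | zero => intro h; simp [pulls, spent]
    | succ t ih =>
      rintro ⟨h, s⟩
      have h1 := ih h
      have h2 := hcost s.1
      simp only [pulls, spent]
      split_ifs with hA
      · have := hS _ hA.2
        push_cast
        linarith
      · simp only [add_zero]
        linarith
  induction t with
  | zero => exact Filter.Eventually.of_forall fun h => by simpa [pulls] using hB
  | succ t ih =>
    have hm : Measurable fun h : Hist N K (t + 1) => c * (pulls cost B S (t + 1) h : ℝ) :=
      (measurable_from_nat.comp (measurable_pulls cost B S (t + 1))).const_mul c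
    refine ae_histLaw_succ M L t (measurableSet_le hm measurable_const) ?_
    filter_upwards [ih] with h hh
    by_cases hA : Active cost B t h
    · filter_upwards [L.affordable t h hA] with a ha z
      simp only [pulls]
      split_ifs with h1
      · have h2 := hle t h
        have h3 := hS _ h1.2
        push_cast
        linarith
      · simpa using hh
    · refine Filter.Eventually.of_forall fun a z => ?_
      simpa [pulls, hA] using hh

end History

/-! ### Change of measure -/

section ChangeOfMeasure

variable {N K : ℕ} {cost : Arm N K → ℝ} {B : ℝ}

/-- The likelihood ratio of the active rounds when the mean of the arm `b` is raised from `-δ`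
to `δ`. -/
def weight (cost : Arm N K → ℝ) (B δ : ℝ) (b : Arm N K) (t : ℕ) (h : Hist N K t) : ℝ≥0∞ :=
  ENNReal.ofReal (Real.exp (2 * δ * armYield cost B b t h))

theorem measurable_weight (δ : ℝ) (b : Arm N K) (t : ℕ) : Measurable (weight cost B δ b t) :=
  (Real.measurable_exp.comp ((measurable_armYield cost B b t).const_mul _)).ennreal_ofReal

theorem measurable_flipDensity [NeZero K] (δ : ℝ) (b : Arm N K) :
    Measurable fun s : Arm N K × Config N K => flipDensity δ b s.1 s.2 :=
  (Real.measurable_exp.comp ((Measurable.ite (measurable_fst (MeasurableSet.of_discrete (s := {b})))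
    measurable_snd.snd measurable_const).const_mul _)).ennreal_ofReal

theorem weight_succ_of_active [NeZero K] {δ : ℝ} {b : Arm N K} {t : ℕ} {h : Hist N K t}
    (hA : Active cost B t h) (s : Arm N K × Config N K) :
    weight cost B δ b (t + 1) (h, s) = flipDensity δ b s.1 s.2 * weight cost B δ b t h := by
  unfold weight flipDensity
  rw [← ENNReal.ofReal_mul (Real.exp_pos _).le, ← Real.exp_add]
  simp only [armYield, hA, true_and]
  congr 2
  ring

theorem weight_succ_of_not_active {δ : ℝ} {b : Arm N K} {t : ℕ} {h : Hist N K t}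
    (hA : ¬ Active cost B t h) (s : Arm N K × Config N K) :
    weight cost B δ b (t + 1) (h, s) = weight cost B δ b t h := by
  simp [weight, armYield, hA]

theorem Active.of_succ (hcost : ∀ a, 0 ≤ cost a) {t : ℕ} {h : Hist N K t}
    {s : Arm N K × Config N K} (hA : Active cost B (t + 1) (h, s)) : Active cost B t h := by
  have := hcost s.1
  simp only [Active, spent] at hA ⊢
  linarith

variable [NeZero K] {G : ADMG N} {M M' : SCM G K} {δ : ℝ} {b : Arm N K}

/-- The policy sees only the history, so it is the same kernel in both models and contributes
nothing to the likelihood ratio. -/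
theorem lintegral_stepKernel_flip
    (hflip : ∀ (a : Arm N K) (f : Config N K → ℝ≥0∞), Measurable f →
      ∫⁻ z, f z ∂M'.law a = ∫⁻ z, flipDensity δ b a z * f z ∂M.law a)
    (L : Learner cost B) (t : ℕ) (h : Hist N K t) {f : Arm N K × Config N K → ℝ≥0∞}
    (hf : Measurable f) :
    ∫⁻ s, f s ∂stepKernel M' L t h =
      ∫⁻ s, flipDensity δ b s.1 s.2 * f s ∂stepKernel M L t h := by
  have hm : Measurable fun s => flipDensity δ b s.1 s.2 * f s := (measurable_flipDensity δ b).mul hf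
  rw [lintegral_stepKernel _ _ _ _ hf, lintegral_stepKernel _ _ _ _ hm]
  exact lintegral_congr fun a => hflip a _ (hf.comp measurable_prodMk_left)

/-- The weighted step under `M` is a step under `M'` as long as the budget is not consumed. -/
theorem lintegral_weight_succ
    (hflip : ∀ (a : Arm N K) (f : Config N K → ℝ≥0∞), Measurable f →
      ∫⁻ z, f z ∂M'.law a = ∫⁻ z, flipDensity δ b a z * f z ∂M.law a)
    (L : Learner cost B) (t : ℕ) (h : Hist N K t) {f : Arm N K × Config N K → ℝ≥0∞}
    (hf : Measurable f) (hA : Active cost B t h) :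
    ∫⁻ s, weight cost B δ b (t + 1) (h, s) * f s ∂stepKernel M L t h =
      weight cost B δ b t h * ∫⁻ s, f s ∂stepKernel M' L t h := by
  have hm : Measurable fun s => flipDensity δ b s.1 s.2 * f s := (measurable_flipDensity δ b).mul hf
  rw [lintegral_stepKernel_flip hflip L t h hf, ← lintegral_const_mul _ hm]
  refine lintegral_congr fun s => ?_
  rw [weight_succ_of_active hA]
  ring

open Classical in
/-- On the event that the budget is not consumed, `weight` is the density of the law of the
history. -/
theorem lintegral_active_flip (hcost : ∀ a, 0 ≤ cost a)
    (hflip : ∀ (a : Arm N K) (f : Config N K → ℝ≥0∞), Measurable f →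
      ∫⁻ z, f z ∂M'.law a = ∫⁻ z, flipDensity δ b a z * f z ∂M.law a)
    (L : Learner cost B) (t : ℕ) {f : Hist N K t → ℝ≥0∞} (hf : Measurable f) :
    ∫⁻ h, (if Active cost B t h then f h else 0) ∂histLaw M' L t =
      ∫⁻ h, (if Active cost B t h then weight cost B δ b t h * f h else 0) ∂histLaw M L t := by
  induction t with
  | zero =>
    refine lintegral_congr fun h => ?_
    simp [weight, armYield]
  | succ t ih =>
    have hmA := measurableSet_active cost B (t + 1)
    have hm1 : Measurable fun q => if Active cost B (t + 1) q then f q else 0 :=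
      Measurable.ite hmA hf measurable_const
    have hm2 : Measurable fun q => if Active cost B (t + 1) q then
        weight cost B δ b (t + 1) q * f q else 0 :=
      Measurable.ite hmA ((measurable_weight δ b (t + 1)).mul hf) measurable_const
    rw [lintegral_histLaw_succ _ _ _ hm1, lintegral_histLaw_succ _ _ _ hm2]
    have hF : Measurable fun h => ∫⁻ s, (if Active cost B (t + 1) (h, s) then
        f (h, s) else 0) ∂stepKernel M' L t h :=
      Measurable.lintegral_kernel_prod_right' (κ := stepKernel M' L t) hm1
    -- Once inactive, always inactive. Hence the integrand over the last step can be truncated to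
    -- active `h`, the form to which the induction hypothesis applies.
    have h0 : ∀ h, ¬ Active cost B t h → ∀ s, ¬ Active cost B (t + 1) (h, s) :=
      fun h hA s hA' => hA (hA'.of_succ hcost)
    calc
      _ = ∫⁻ h, (if Active cost B t h then ∫⁻ s, (if Active cost B (t + 1) (h, s) then
            f (h, s) else 0) ∂stepKernel M' L t h else 0) ∂histLaw M' L t := by
        refine lintegral_congr fun h => ?_
        by_cases hA : Active cost B t h
        · rw [if_pos hA]
        · simp [hA, h0 h hA]
      _ = _ := by
        rw [ih hF]
        refine lintegral_congr fun h => ?_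
        by_cases hA : Active cost B t h
        · have hm3 : Measurable fun s => if Active cost B (t + 1) (h, s) then f (h, s) else 0 :=
            hm1.comp (measurable_prodMk_left (x := h))
          rw [if_pos hA, ← lintegral_weight_succ hflip L t h hm3 hA]
          refine lintegral_congr fun s => ?_
          split_ifs <;> simp
        · simp [hA, h0 h hA]

/-- The weight is frozen once the budget is consumed, so it is no density for the full history law
afterwards, but its total mass stays `1`. -/
theorem lintegral_weight
    (hflip : ∀ (a : Arm N K) (f : Config N K → ℝ≥0∞), Measurable f →
      ∫⁻ z, f z ∂M'.law a = ∫⁻ z, flipDensity δ b a z * f z ∂M.law a)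
    (L : Learner cost B) (t : ℕ) :
    ∫⁻ h, weight cost B δ b t h ∂histLaw M L t = 1 := by
  induction t with
  | zero =>
    have : ∀ h : Hist N K 0, weight cost B δ b 0 h = 1 := fun h => by simp [weight, armYield]
    simp [this]
  | succ t ih =>
    rw [lintegral_histLaw_succ _ _ _ (measurable_weight δ b (t + 1)), ← ih]
    refine lintegral_congr fun h => ?_
    by_cases hA : Active cost B t h
    · simpa using lintegral_weight_succ hflip L t h (measurable_const (a := (1 : ℝ≥0∞))) hA
    · simp [weight_succ_of_not_active hA]

/-- The expected number of pulls under `M'`, expressed by the law of the history under `M`. -/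
theorem lintegral_pulls_flip (hcost : ∀ a, 0 ≤ cost a)
    (hflip : ∀ (a : Arm N K) (f : Config N K → ℝ≥0∞), Measurable f →
      ∫⁻ z, f z ∂M'.law a = ∫⁻ z, flipDensity δ b a z * f z ∂M.law a)
    (L : Learner cost B) (S : Set (Arm N K)) (t : ℕ) :
    ∫⁻ h, (pulls cost B S t h : ℝ≥0∞) ∂histLaw M' L t =
      ∫⁻ h, weight cost B δ b t h * pulls cost B S t h ∂histLaw M L t := by
  classical
  have hmp : ∀ t, Measurable fun h : Hist N K t => (pulls cost B S t h : ℝ≥0∞) :=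
    fun t => measurable_from_nat.comp (measurable_pulls cost B S t)
  induction t with
  | zero => simp [pulls]
  | succ t ih =>
    let g : Arm N K × Config N K → ℝ≥0∞ := fun s => if s.1 ∈ S then 1 else 0
    have hg : Measurable g := Measurable.ite (measurable_fst (MeasurableSet.of_discrete (s := S)))
      measurable_const measurable_const
    -- The increment lives on active histories only, exactly where the weight is a density.
    have hp : ∀ h s, (pulls cost B S (t + 1) (h, s) : ℝ≥0∞) =
        pulls cost B S t h + if Active cost B t h then g s else 0 := by
      intro h s
      by_cases hA : Active cost B t h <;> by_cases hs : s.1 ∈ S <;> simp [pulls, g, hA, hs]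
    have hF : Measurable fun h => ∫⁻ s, g s ∂stepKernel M' L t h :=
      Measurable.lintegral_kernel_prod_right' (κ := stepKernel M' L t) (hg.comp measurable_snd)
    have hmA : Measurable fun h : Hist N K t => if Active cost B t h then
        weight cost B δ b t h * ∫⁻ s, g s ∂stepKernel M' L t h else 0 :=
      Measurable.ite (measurableSet_active cost B t) ((measurable_weight δ b t).mul hF)
        measurable_const
    have hwp : Measurable fun h : Hist N K (t + 1) =>
        weight cost B δ b (t + 1) h * pulls cost B S (t + 1) h :=
      (measurable_weight δ b (t + 1)).mul (hmp (t + 1))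
    rw [lintegral_histLaw_succ _ _ _ (hmp (t + 1)), lintegral_histLaw_succ _ _ _ hwp]
    calc
      _ = ∫⁻ h, ((pulls cost B S t h : ℝ≥0∞) + if Active cost B t h then
            ∫⁻ s, g s ∂stepKernel M' L t h else 0) ∂histLaw M' L t := by
        refine lintegral_congr fun h => ?_
        by_cases hA : Active cost B t h
        · simp only [hp, hA, if_true]
          rw [lintegral_add_left measurable_const]
          simp
        · simp [hp, hA]
      _ = ∫⁻ h, weight cost B δ b t h * pulls cost B S t h ∂histLaw M L t +
            ∫⁻ h, (if Active cost B t h then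
              weight cost B δ b t h * ∫⁻ s, g s ∂stepKernel M' L t h else 0) ∂histLaw M L t := by
        rw [lintegral_add_left (hmp t), ih, lintegral_active_flip hcost hflip L t hF]
      _ = _ := by
        rw [← lintegral_add_right _ hmA]
        refine lintegral_congr fun h => ?_
        by_cases hA : Active cost B t h
        · have hm3 : Measurable fun s => (pulls cost B S t h : ℝ≥0∞) + g s :=
            hg.const_add _
          simp only [hp, hA, if_true]
          rw [lintegral_weight_succ hflip L t h hm3 hA, lintegral_add_left measurable_const, mul_add]
          simp
        · simp [hp, hA, weight_succ_of_not_active hA]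

end ChangeOfMeasure

/-! ### Wald's identity and the effect of a flip on the expected number of pulls -/

section Yield

variable {N K : ℕ} {cost : Arm N K → ℝ} {B : ℝ} [NeZero K] {G : ADMG N} {M : SCM G K}
  {b : Arm N K}

theorem integrable_pulls (M : SCM G K) (L : Learner cost B) (S : Set (Arm N K)) (t : ℕ) :
    Integrable (fun h => (pulls cost B S t h : ℝ)) (histLaw M L t) := by
  refine Integrable.of_bound (C := t)
    (measurable_from_nat.comp (measurable_pulls cost B S t)).aestronglyMeasurable
    (Filter.Eventually.of_forall fun h => ?_)
  simpa using pulls_le cost B S t h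

theorem integrable_histLaw_fst {L : Learner cost B} {t : ℕ} {f : Hist N K t → ℝ}
    (hf : Integrable f (histLaw M L t)) :
    Integrable (fun q : Hist N K (t + 1) => f q.1) (histLaw M L (t + 1)) := by
  have h1 : ((histLaw M L t) ⊗ₘ (stepKernel M L t)).map Prod.fst = histLaw M L t :=
    Measure.fst_compProd _ _
  rw [← h1] at hf
  exact hf.comp_measurable measurable_fst

theorem integral_histLaw_fst {L : Learner cost B} {t : ℕ} {f : Hist N K t → ℝ}
    (hf : AEStronglyMeasurable f (histLaw M L t)) :
    ∫ q, (fun q : Hist N K (t + 1) => f q.1) q ∂histLaw M L (t + 1) = ∫ h, f h ∂histLaw M L t := by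
  have h1 : ((histLaw M L t) ⊗ₘ (stepKernel M L t)).map Prod.fst = histLaw M L t :=
    Measure.fst_compProd _ _
  rw [← h1] at hf
  have h2 := (integral_map measurable_fst.aemeasurable hf).symm
  rw [h1] at h2
  exact h2

theorem integral_histLaw_succ {L : Learner cost B} {t : ℕ} {f : Hist N K (t + 1) → ℝ}
    (hf : Integrable f (histLaw M L (t + 1))) :
    ∫ q, f q ∂histLaw M L (t + 1) =
      ∫ h, ∫ a, ∫ z, f (h, (a, z)) ∂M.law a ∂L.policy t h ∂histLaw M L t := by
  have hf' : Integrable f ((histLaw M L t) ⊗ₘ (stepKernel M L t)) := hf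
  have h1 := Measure.integral_compProd (μ := histLaw M L t) (κ := stepKernel M L t) hf'
  refine h1.trans (integral_congr_ae ?_)
  filter_upwards [hf'.ae_of_compProd] with h hh
  exact ProbabilityTheory.integral_compProd hh

-- Whatever the history, the conditional expectation of the absolute increment is at most that of
-- the absolute reward under `b`.
open Classical in
theorem integrable_armYield_step (L : Learner cost B)
    (hint : Integrable (fun z : Config N K => z.2) (M.law b)) (t : ℕ) :
    Integrable (fun q : Hist N K (t + 1) =>
      if Active cost B t q.1 ∧ q.2.1 = b then q.2.2.2 else 0) (histLaw M L (t + 1)) := by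
  have hm : Measurable fun q : Hist N K (t + 1) =>
      if Active cost B t q.1 ∧ q.2.1 = b then q.2.2.2 else 0 :=
    measurable_armYield_step cost B b t
  refine ⟨hm.aestronglyMeasurable, ?_⟩
  unfold HasFiniteIntegral
  rw [lintegral_histLaw_succ _ _ _ hm.enorm]
  refine lt_of_le_of_lt (b := ∫⁻ z, ‖z.2‖ₑ ∂M.law b) ?_ hint.2
  have hstep : ∀ h : Hist N K t, ∫⁻ s, ‖(if Active cost B t h ∧ s.1 = b then s.2.2 else 0 : ℝ)‖ₑ
      ∂stepKernel M L t h ≤ ∫⁻ z, ‖z.2‖ₑ ∂M.law b := by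
    intro h
    rw [lintegral_stepKernel _ _ _ _
      (hm.enorm.comp (measurable_prodMk_left (x := h)) :
        Measurable fun s => ‖(if Active cost B t h ∧ s.1 = b then s.2.2 else 0 : ℝ)‖ₑ)]
    calc
      _ ≤ ∫⁻ _, (∫⁻ z, ‖z.2‖ₑ ∂M.law b) ∂L.policy t h := by
        refine lintegral_mono fun a => ?_
        by_cases ha : a = b
        · subst ha
          refine lintegral_mono fun z => ?_
          dsimp only
          split_ifs <;> simp
        · simp [ha]
      _ = _ := by simp
  calc
    _ ≤ ∫⁻ _, (∫⁻ z, ‖z.2‖ₑ ∂M.law b) ∂histLaw M L t := lintegral_mono hstep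
    _ = _ := by simp

theorem integrable_armYield (L : Learner cost B)
    (hint : Integrable (fun z : Config N K => z.2) (M.law b)) (t : ℕ) :
    Integrable (armYield cost B b t) (histLaw M L t) := by
  classical
  induction t with
  | zero => exact integrable_const (0 : ℝ)
  | succ t ih => exact (integrable_histLaw_fst ih).add (integrable_armYield_step L hint t)

/-- Wald's identity: the expected total reward of the arm `b` is its mean times the expected number
of its pulls. -/
theorem integral_armYield (L : Learner cost B)
    (hint : Integrable (fun z : Config N K => z.2) (M.law b)) (t : ℕ) :
    ∫ h, armYield cost B b t h ∂histLaw M L t =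
      M.mean b * ∫ h, (pulls cost B {b} t h : ℝ) ∂histLaw M L t := by
  classical
  induction t with
  | zero => simp [armYield, pulls]
  | succ t ih =>
    have hY := integrable_armYield L hint t
    have hS := integrable_armYield_step L hint t
    have hP := integrable_pulls M L {b} t
    have hP' := integrable_pulls M L {b} (t + 1)
    have hm : Measurable fun q : Hist N K (t + 1) =>
        if Active cost B t q.1 ∧ q.2.1 = b then M.mean b else 0 :=
      Measurable.ite (measurableSet_active_and cost B t {b}) measurable_const measurable_const
    have hI : Integrable (fun q : Hist N K (t + 1) =>
        if Active cost B t q.1 ∧ q.2.1 = b then M.mean b else 0) (histLaw M L (t + 1)) := by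
      refine Integrable.of_bound (C := |M.mean b|) hm.aestronglyMeasurable
        (Filter.Eventually.of_forall fun q => ?_)
      split_ifs <;> simp
    have h1 : ∫ q, armYield cost B b (t + 1) q ∂histLaw M L (t + 1) =
        ∫ h, armYield cost B b t h ∂histLaw M L t +
          ∫ q, (fun q : Hist N K (t + 1) =>
            if Active cost B t q.1 ∧ q.2.1 = b then q.2.2.2 else 0) q ∂histLaw M L (t + 1) := by
      rw [← integral_histLaw_fst hY.1, ← integral_add (integrable_histLaw_fst hY) hS]
      rfl
    have h2 : M.mean b * ∫ q, (pulls cost B {b} (t + 1) q : ℝ) ∂histLaw M L (t + 1) =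
        M.mean b * ∫ h, (pulls cost B {b} t h : ℝ) ∂histLaw M L t +
          ∫ q, (fun q : Hist N K (t + 1) =>
            if Active cost B t q.1 ∧ q.2.1 = b then M.mean b else 0) q ∂histLaw M L (t + 1) := by
      rw [← integral_histLaw_fst hP.1, ← integral_const_mul, ← integral_const_mul,
        ← integral_add ((integrable_histLaw_fst hP).const_mul _) hI]
      refine integral_congr_ae (Filter.Eventually.of_forall ?_)
      rintro ⟨h, s⟩
      simp only [pulls, Set.mem_singleton_iff]
      split_ifs <;> push_cast <;> ring
    -- Whether a pull counts is settled before its reward is drawn, so the inner integral replaces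
    -- the reward by its mean.
    rw [h1, h2, ih, integral_histLaw_succ hS, integral_histLaw_succ hI]
    congr 1
    refine integral_congr_ae (Filter.Eventually.of_forall fun h => ?_)
    refine integral_congr_ae (Filter.Eventually.of_forall fun a => ?_)
    by_cases hA : Active cost B t h ∧ a = b
    · obtain ⟨hA, rfl⟩ := hA
      simp [hA, M.integral_snd_law]
    · simp [hA]

/-- A pointwise substitute for Pinsker's inequality. With `q = exp (w / 2)`, the inequality of
arithmetic and geometric means gives `|q² - 1| ≤ 8 (q - 1)² + (q + 1)² / 32 = 257/32 (q² + 1) -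
255/16 q`, and `q ≥ 1 + w / 2` bounds the last term. For a likelihood ratio `exp w` of mean `1`, the
right side has expectation `1/8 - 255/32 E[w]`, where `-E[w]` is the relative entropy. -/
theorem abs_exp_sub_one_le (w : ℝ) :
    |Real.exp w - 1| ≤ 257 / 32 * (Real.exp w + 1) - 255 / 16 - 255 / 32 * w := by
  set q := Real.exp (w / 2) with hq
  have h1 : Real.exp w = q ^ 2 := by rw [hq, ← Real.exp_nat_mul]; congr 1; push_cast; ring
  have h2 : w / 2 + 1 ≤ q := Real.add_one_le_exp _
  rw [h1, abs_le]
  constructor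
  · nlinarith [sq_nonneg (16 * (q - 1) - (q + 1)), sq_nonneg (16 * (q - 1) + (q + 1))]
  · nlinarith [sq_nonneg (16 * (q - 1) - (q + 1)), sq_nonneg (16 * (q - 1) + (q + 1))]

/-- If the arm `b` is rarely pulled under `M`, then raising its mean from `-δ` to `δ` does not
increase the number of its pulls by much. -/
theorem integral_pulls_flip_le {M' : SCM G K} {δ : ℝ} (hcost : ∀ a, 0 ≤ cost a) (hB : 0 ≤ B)
    (hc : 0 < cost b)
    (hflip : ∀ (a : Arm N K) (f : Config N K → ℝ≥0∞), Measurable f →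
      ∫⁻ z, f z ∂M'.law a = ∫⁻ z, flipDensity δ b a z * f z ∂M.law a)
    (hint : Integrable (fun z : Config N K => z.2) (M.law b)) (hmean : M.mean b = -δ)
    (L : Learner cost B) (t : ℕ) :
    ∫ h, (pulls cost B {b} t h : ℝ) ∂histLaw M' L t ≤
      ∫ h, (pulls cost B {b} t h : ℝ) ∂histLaw M L t + ⌊B / cost b⌋₊ *
        (1 / 8 + 16 * δ ^ 2 * ∫ h, (pulls cost B {b} t h : ℝ) ∂histLaw M L t) := by
  set n : ℝ := (⌊B / cost b⌋₊ : ℝ) with hn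
  set Z : Hist N K t → ℝ := fun h => Real.exp (2 * δ * armYield cost B b t h) with hZ
  have hYm := measurable_armYield cost B b t
  have hZm : Measurable Z := Real.measurable_exp.comp (hYm.const_mul _)
  have hpm : Measurable fun h : Hist N K t => (pulls cost B {b} t h : ℝ) :=
    measurable_from_nat.comp (measurable_pulls cost B {b} t)
  have hp0 : ∀ h : Hist N K t, (0 : ℝ) ≤ pulls cost B {b} t h := fun h => Nat.cast_nonneg _
  have hZ0 : ∀ h, 0 ≤ Z h := fun h => (Real.exp_pos _).le
  have hZ1 : ∫⁻ h, ENNReal.ofReal (Z h) ∂histLaw M L t = 1 := lintegral_weight hflip L t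
  have hZi : Integrable Z (histLaw M L t) := by
    refine ⟨hZm.aestronglyMeasurable, ?_⟩
    rw [hasFiniteIntegral_iff_ofReal (Filter.Eventually.of_forall hZ0), hZ1]
    exact ENNReal.one_lt_top
  have hZint : ∫ h, Z h ∂histLaw M L t = 1 := by
    rw [integral_eq_lintegral_of_nonneg_ae (Filter.Eventually.of_forall hZ0)
      hZm.aestronglyMeasurable, hZ1, ENNReal.toReal_one]
  have hpi := integrable_pulls M L {b} t
  have hYi := integrable_armYield L hint t
  have hZp : Integrable (fun h => Z h * pulls cost B {b} t h) (histLaw M L t) := by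
    refine hZi.mul_bdd (c := t) hpm.aestronglyMeasurable
      (Filter.Eventually.of_forall fun h => ?_)
    simpa using pulls_le cost B {b} t h
  have hchange : ∫ h, (pulls cost B {b} t h : ℝ) ∂histLaw M' L t =
      ∫ h, Z h * pulls cost B {b} t h ∂histLaw M L t := by
    rw [integral_eq_lintegral_of_nonneg_ae (Filter.Eventually.of_forall hp0)
      hpm.aestronglyMeasurable, integral_eq_lintegral_of_nonneg_ae
      (Filter.Eventually.of_forall fun h => mul_nonneg (hZ0 h) (hp0 h)) hZp.1]
    congr 1
    simp only [ENNReal.ofReal_natCast, ENNReal.ofReal_mul (hZ0 _)]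
    exact lintegral_pulls_flip hcost hflip L {b} t
  -- The cap is what the budget allows for `b`, not the number of rounds `t`.
  have hle : ∀ᵐ h ∂histLaw M L t, (pulls cost B {b} t h : ℝ) ≤ n := by
    filter_upwards [mul_pulls_le M L hcost hB (S := {b}) (c := cost b)
      (fun a ha => by rw [Set.mem_singleton_iff.1 ha]) t] with h hh
    rw [hn]
    exact_mod_cast Nat.le_floor ((le_div_iff₀ hc).2 (by linarith))
  set R : Hist N K t → ℝ := fun h => 257 / 32 * (Z h + 1) - 255 / 16 -
    255 / 32 * (2 * δ * armYield cost B b t h) with hR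
  have hRi : Integrable R (histLaw M L t) :=
    (((hZi.add (integrable_const 1)).const_mul _).sub (integrable_const _)).sub
      ((hYi.const_mul _).const_mul _)
  -- `Z` has mean `1`, and by Wald's identity the mean of `log Z` is `-2 δ²` times the expected
  -- pulls of `b` under `M`.
  have hRint : ∫ h, R h ∂histLaw M L t = 1 / 8 + 255 / 16 * δ ^ 2 *
      ∫ h, (pulls cost B {b} t h : ℝ) ∂histLaw M L t := by
    have hi1 : Integrable (fun h => 257 / 32 * (Z h + 1)) (histLaw M L t) :=
      (hZi.add (integrable_const 1)).const_mul _
    have hi2 : Integrable (fun h => 257 / 32 * (Z h + 1) - 255 / 16) (histLaw M L t) :=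
      hi1.sub (integrable_const _)
    rw [hR, integral_sub hi2 ((hYi.const_mul _).const_mul _),
      integral_sub hi1 (integrable_const _), integral_const_mul, integral_const_mul,
      integral_const_mul, integral_add hZi (integrable_const _), hZint,
      integral_armYield L hint t, hmean]
    simp
    ring
  have hP0 : 0 ≤ ∫ h, (pulls cost B {b} t h : ℝ) ∂histLaw M L t := integral_nonneg hp0
  have hn0 : 0 ≤ n := Nat.cast_nonneg _
  rw [hchange]
  calc
    _ ≤ ∫ h, ((pulls cost B {b} t h : ℝ) + n * R h) ∂histLaw M L t := by
      refine integral_mono_ae hZp (hpi.add (hRi.const_mul _)) ?_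
      filter_upwards [hle] with h hh
      have h1 : |Z h - 1| ≤ R h := abs_exp_sub_one_le _
      have h2 := (abs_le.1 h1).2
      have h3 := abs_nonneg (Z h - 1)
      have h4 := hp0 h
      have h5 := le_abs_self (Z h - 1)
      have h6 : (pulls cost B {b} t h : ℝ) * (Z h - 1) ≤ n * R h :=
        (mul_le_mul_of_nonneg_left h2 h4).trans
          (mul_le_mul_of_nonneg_right hh (h3.trans h1))
      linarith
    _ ≤ _ := by
      rw [integral_add hpi (hRi.const_mul _), integral_const_mul, hRint]
      have := mul_nonneg (sq_nonneg δ) hP0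
      gcongr
      linarith

end Yield

/-! ### Rewards -/

section Reward

variable {N K : ℕ} [NeZero K] {G : ADMG N} {cost : Arm N K → ℝ} {B : ℝ}

theorem accumulated_eq_sum (M : SCM G K) (t : ℕ) (h : Hist N K t) :
    accumulated M cost B t h = ∑ a, M.mean a * pulls cost B {a} t h := by
  classical
  induction t with
  | zero => simp [accumulated, pulls]
  | succ t ih =>
    obtain ⟨h, s⟩ := h
    simp only [accumulated, pulls, ih h, Nat.cast_add, mul_add, Finset.sum_add_distrib]
    congr 1
    by_cases hA : Active cost B t h <;> simp [hA]

theorem measurable_accumulated (M : SCM G K) (t : ℕ) : Measurable (accumulated M cost B t) := by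
  have h1 : accumulated M cost B t = fun h => ∑ a, M.mean a * (pulls cost B {a} t h : ℝ) :=
    funext fun h => accumulated_eq_sum M t h
  rw [h1]
  exact Finset.measurable_sum _ fun a _ =>
    (measurable_from_nat.comp (measurable_pulls cost B {a} t)).const_mul _

/-- The expected number of pulls of arms in `S` until the budget is consumed. -/
def expectedPulls (M : SCM G K) (L : Learner cost B) (S : Set (Arm N K)) : ℝ :=
  ∫ h, (pulls cost B S ⌊B / minCost cost⌋₊ h : ℝ) ∂(histLaw M L ⌊B / minCost cost⌋₊)

theorem expectedPulls_nonneg (M : SCM G K) (L : Learner cost B) (S : Set (Arm N K)) :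
    0 ≤ expectedPulls M L S :=
  integral_nonneg fun _ => Nat.cast_nonneg _

theorem expectedReward_eq_sum (M : SCM G K) (L : Learner cost B) :
    expectedReward M L = ∑ a, M.mean a * expectedPulls M L {a} := by
  unfold expectedReward expectedPulls
  simp only [accumulated_eq_sum]
  rw [integral_finsetSum _ fun a _ => (integrable_pulls M L {a} _).const_mul _]
  simp only [integral_const_mul]

theorem expectedReward_le_optimalReward (M : SCM G K) (L : Learner cost B) :
    expectedReward M L ≤ optimalReward M cost B :=
  le_ciSup (bddAbove_expectedReward M cost B) L

/-- The learner that pulls the arm `b` while it is affordable, and only observes afterwards. -/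
def repeatLearner (hnone : cost none = minCost cost) (b : Arm N K) : Learner cost B where
  policy t := Kernel.deterministic (repeatArm cost B b t) (measurable_repeatArm b t)
  policy_markov _ := inferInstance
  affordable t h hA := by
    rw [Kernel.deterministic_apply, ae_dirac_iff MeasurableSet.of_discrete]
    unfold repeatArm
    split_ifs with h1
    · exact h1
    -- As `a_0` is a cheapest arm, it is affordable whenever any arm is.
    · rw [hnone]
      exact hA

/-- The exact spending in the third clause keeps `b` affordable for the first `⌊B / cost b⌋₊`
rounds, which drives the count in the second. The first clause holds because the fallback arm `a_0`
has mean `0`. -/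
theorem ae_repeatLearner (M : SCM G K) (hnone : cost none = minCost cost) (hB : 0 ≤ B)
    {b : Arm N K} (hb : b ≠ none) (hpos : 0 < cost b) (hmean : M.mean none = 0) (t : ℕ) :
    ∀ᵐ h ∂histLaw M (repeatLearner (B := B) hnone b) t,
      accumulated M cost B t h = M.mean b * pulls cost B {b} t h ∧
      min t ⌊B / cost b⌋₊ ≤ pulls cost B {b} t h ∧
      (t ≤ ⌊B / cost b⌋₊ → spent cost t h = t * cost b) := by
  classical
  induction t with
  | zero =>
    exact Filter.Eventually.of_forall fun h => by simp [accumulated, pulls, spent]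
  | succ t ih =>
    have hpm : Measurable fun h : Hist N K (t + 1) => (pulls cost B {b} (t + 1) h : ℝ) :=
      measurable_from_nat.comp (measurable_pulls cost B {b} (t + 1))
    have hm : MeasurableSet {h : Hist N K (t + 1) |
        accumulated M cost B (t + 1) h = M.mean b * pulls cost B {b} (t + 1) h ∧
        min (t + 1) ⌊B / cost b⌋₊ ≤ pulls cost B {b} (t + 1) h ∧
        (t + 1 ≤ ⌊B / cost b⌋₊ → spent cost (t + 1) h = ((t + 1 : ℕ) : ℝ) * cost b)} := by
      refine (measurableSet_eq_fun (measurable_accumulated M (t + 1)) (hpm.const_mul _)).inter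
        ((measurableSet_le measurable_const (measurable_pulls cost B {b} (t + 1))).inter ?_)
      exact (MeasurableSet.const _).imp
        (measurableSet_eq_fun (measurable_spent cost (t + 1)) measurable_const)
    refine ae_histLaw_succ M _ t hm ?_
    filter_upwards [ih] with h hh
    have hpol : (repeatLearner (B := B) hnone b).policy t h =
        Measure.dirac (repeatArm cost B b t h) :=
      Kernel.deterministic_apply (measurable_repeatArm b t) _
    rw [hpol, ae_dirac_iff MeasurableSet.of_discrete]
    intro z
    obtain ⟨h1, h2, h3⟩ := hh
    refine ⟨?_, ?_, ?_⟩
    · simp only [accumulated, pulls, h1, repeatArm]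
      by_cases hs : spent cost t h + cost b ≤ B <;> by_cases hA : Active cost B t h <;>
        simp [hs, hA, hmean, hb.symm, mul_add]
    · by_cases ht : t + 1 ≤ ⌊B / cost b⌋₊
      · have hs : spent cost t h + cost b ≤ B := by
          rw [h3 (by omega)]
          have := (Nat.le_floor_iff (div_nonneg hB hpos.le)).1 ht
          rw [le_div_iff₀ hpos] at this
          push_cast at this
          linarith
        have hA : Active cost B t h := by
          have := minCost_le cost b
          unfold Active
          linarith
        simp only [pulls, repeatArm, hs, hA, if_true, Set.mem_singleton_iff, and_self]
        omega
      · simp only [pulls]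
        omega
    · intro ht
      have hs : spent cost t h + cost b ≤ B := by
        rw [h3 (by omega)]
        have := (Nat.le_floor_iff (div_nonneg hB hpos.le)).1 ht
        rw [le_div_iff₀ hpos] at this
        push_cast at this
        linarith
      simp only [spent, repeatArm, hs, if_true]
      rw [h3 (by omega)]
      push_cast
      ring

/-- Repeating one arm is a lower bound for the optimum. -/
theorem le_optimalReward (M : SCM G K) (hcost : ∀ a, 1 ≤ cost a) (hnone : cost none = minCost cost)
    (hB : 0 ≤ B) {b : Arm N K} (hb : b ≠ none) (hmean : M.mean none = 0) (hb0 : 0 ≤ M.mean b) :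
    ⌊B / cost b⌋₊ * M.mean b ≤ optimalReward M cost B := by
  have hpos : 0 < cost b := one_pos.trans_le (hcost b)
  have hmin : 0 < minCost cost := one_pos.trans_le (one_le_minCost hcost)
  refine le_trans ?_ (expectedReward_le_optimalReward M (repeatLearner hnone b))
  have hae := ae_repeatLearner M hnone hB hb hpos hmean ⌊B / minCost cost⌋₊
  have hT : ⌊B / cost b⌋₊ ≤ ⌊B / minCost cost⌋₊ :=
    Nat.floor_le_floor (div_le_div_of_nonneg_left hB hmin (minCost_le cost b))
  rw [min_eq_right hT] at hae
  have h1 : ∫ _, (⌊B / cost b⌋₊ * M.mean b : ℝ)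
      ∂histLaw M (repeatLearner (B := B) hnone b) ⌊B / minCost cost⌋₊ ≤
      ∫ h, M.mean b * (pulls cost B {b} ⌊B / minCost cost⌋₊ h : ℝ)
        ∂histLaw M (repeatLearner (B := B) hnone b) ⌊B / minCost cost⌋₊ := by
    refine integral_mono_ae (integrable_const _) ((integrable_pulls M _ {b} _).const_mul _) ?_
    filter_upwards [hae] with h hh
    rw [mul_comm]
    exact mul_le_mul_of_nonneg_left (Nat.cast_le.2 hh.2.1) hb0
  rw [integral_const, probReal_univ, one_smul] at h1
  refine h1.trans (le_of_eq (integral_congr_ae ?_))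
  filter_upwards [hae] with h hh
  exact hh.1.symm

end Reward

theorem minCost_armCost {N K : ℕ} {c₀ c : ℝ} (hc : c₀ ≤ c) :
    minCost (armCost c₀ c : Arm N K → ℝ) = c₀ := by
  refine le_antisymm (minCost_le (armCost c₀ c) none) (le_ciInf fun a => ?_)
  rcases a with _ | p
  · exact le_rfl
  · exact hc

/-! ### The hard instances -/

section Hard

variable {N K : ℕ} [NeZero K]

/-- All interventions with a nonzero value have mean effect `-δ`. -/
def nullEffect (δ : ℝ) (p : Fin N × Fin K) : ℝ := if p.2 = 0 then 0 else -δ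

/-- As `nullEffect`, but the intervention `q` has mean effect `δ`. -/
def flippedEffect (δ : ℝ) (q p : Fin N × Fin K) : ℝ :=
  if p.2 = 0 then 0 else if p = q then δ else -δ

/-- The interventions with a nonzero value. -/
def effective (N K : ℕ) [NeZero K] : Finset (Fin N × Fin K) :=
  Finset.univ ×ˢ Finset.univ.erase 0

theorem card_effective : (effective N K).card = N * (K - 1) := by
  simp [effective, Finset.card_product]

theorem mem_effective {p : Fin N × Fin K} : p ∈ effective N K ↔ p.2 ≠ 0 := by
  simp [effective]

theorem additiveSCM_gaussian {θ : Fin N × Fin K → ℝ} (hθ : ∀ i, θ (i, 0) = 0) {R : ℝ}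
    (hR : 0 ≤ R) (hb : ∀ p, |θ p| ≤ R) (a : Arm N K) :
    (additiveSCM θ).rewardLaw a = gaussianReal ((additiveSCM θ).mean a) 1 ∧
      |(additiveSCM θ).mean a| ≤ R := by
  rw [mean_additiveSCM hθ, rewardLaw_additiveSCM hθ]
  refine ⟨rfl, ?_⟩
  rcases a with _ | p
  · simpa [armMean] using hR
  · exact hb p

variable {cost : Arm N K → ℝ} {B : ℝ}

theorem expectedReward_nullEffect (δ : ℝ) (L : Learner cost B) :
    expectedReward (additiveSCM (nullEffect δ)) L =
      -δ * ∑ p ∈ effective N K, expectedPulls (additiveSCM (nullEffect δ)) L {some p} := by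
  rw [expectedReward_eq_sum, Fintype.sum_option, mean_additiveSCM (by simp [nullEffect]),
    Finset.mul_sum]
  simp only [armMean, zero_mul, zero_add]
  refine (Finset.sum_subset_zero_on_sdiff (Finset.subset_univ _) ?_ ?_).symm
  · intro p hp
    have : p.2 = 0 := by simpa [mem_effective] using hp
    rw [mean_additiveSCM (by simp [nullEffect])]
    simp [armMean, nullEffect, this]
  · intro p hp
    rw [mean_additiveSCM (by simp [nullEffect])]
    simp [armMean, nullEffect, mem_effective.1 hp]

/-- Every arm other than `q` has mean at most `0`, so dropping it can only increase the reward. -/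
theorem expectedReward_flippedEffect_le {δ : ℝ} (hδ : 0 ≤ δ) (q : Fin N × Fin K)
    (L : Learner cost B) :
    expectedReward (additiveSCM (flippedEffect δ q)) L ≤
      δ * expectedPulls (additiveSCM (flippedEffect δ q)) L {some q} := by
  rw [expectedReward_eq_sum, ← Finset.sum_erase_add _ _ (Finset.mem_univ (some q))]
  have hz : ∀ i, flippedEffect δ q (i, 0) = 0 := by simp [flippedEffect]
  have h1 : ∑ a ∈ Finset.univ.erase (some q), (additiveSCM (flippedEffect δ q)).mean a *
      expectedPulls (additiveSCM (flippedEffect δ q)) L {a} ≤ 0 := by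
    refine Finset.sum_nonpos fun a ha => mul_nonpos_of_nonpos_of_nonneg ?_
      (expectedPulls_nonneg _ _ _)
    rw [mean_additiveSCM hz]
    rcases a with _ | p
    · exact le_rfl
    · have hp : p ≠ q := fun h => by simp [h] at ha
      simp only [armMean, flippedEffect, hp, if_false]
      split_ifs <;> linarith
  have h2 : (additiveSCM (flippedEffect δ q)).mean (some q) ≤ δ := by
    rw [mean_additiveSCM hz]
    simp only [armMean, flippedEffect, if_true]
    split_ifs <;> linarith
  have h3 := mul_le_mul_of_nonneg_right h2
    (expectedPulls_nonneg (additiveSCM (flippedEffect δ q)) L {some q})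
  linarith

theorem expectedPulls_flippedEffect_le {δ : ℝ} {q : Fin N × Fin K} (hq : q.2 ≠ 0)
    (hcost : ∀ a, 1 ≤ cost a) (hB : 0 ≤ B) (L : Learner cost B) :
    expectedPulls (additiveSCM (flippedEffect δ q)) L {some q} ≤
      expectedPulls (additiveSCM (nullEffect δ)) L {some q} + ⌊B / cost (some q)⌋₊ *
        (1 / 8 + 16 * δ ^ 2 * expectedPulls (additiveSCM (nullEffect δ)) L {some q}) := by
  have hz : ∀ i, flippedEffect δ q (i, 0) = 0 := by simp [flippedEffect]
  have hz' : ∀ i : Fin N, nullEffect δ (i, (0 : Fin K)) = 0 := by simp [nullEffect]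
  have hm : armMean (nullEffect δ) (some q) = -δ := by simp [armMean, nullEffect, hq]
  refine integral_pulls_flip_le (fun a => zero_le_one.trans (hcost a)) hB
    (one_pos.trans_le (hcost _)) (fun a f hf => lintegral_law_flip hz' hz hm ?_ ?_ a hf)
    (integrable_snd_law hz' _) ?_ L _
  · simp [armMean, flippedEffect, hq]
  · rintro (_ | p) hp
    · rfl
    · have : p ≠ q := fun h => hp (by rw [h])
      simp [armMean, flippedEffect, nullEffect, this]
  · rw [mean_additiveSCM hz', hm]

end Hard

end CausalBandit

end

/-! ### The lower bound -/

theorem mainTheorem3 :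
    ∃ κ : ℝ, 0 < κ ∧
      ∀ (N K : ℕ) [NeZero K] (_ : 1 ≤ N) (_ : 2 ≤ K) (c₀ c B : ℝ) (h₀ : 1 ≤ c₀) (hc : c₀ ≤ c)
        (_ : 0 ≤ B) (A : CausalBandit.Algorithm N K B),
        ∃ M : CausalBandit.SCM (CausalBandit.parallelGraph N) K,
          (∀ a, M.rewardLaw a = ProbabilityTheory.gaussianReal (M.mean a) 1 ∧
            |M.mean a| ≤ √((K * N : ℝ) / ⌊B / c⌋₊)) ∧
          κ * √(⌊B / c⌋₊ * (K * N : ℝ)) ≤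
            CausalBandit.cumulativeRegret M
              (A (CausalBandit.parallelGraph N) (CausalBandit.armCost c₀ c)
                (CausalBandit.one_le_armCost h₀ hc)) := by
  open CausalBandit in
  -- `1/128 = 1/32 * 1/4`: the factor in `δ` times the fraction of the `n` pulls of `q` that is
  -- missed in the flipped model.
  refine ⟨1 / 128, by norm_num, ?_⟩
  intro N K _ hN hK c₀ c B h₀ hc hB A
  have hcost : ∀ a : Arm N K, 1 ≤ armCost c₀ c a := one_le_armCost h₀ hc
  have hnone : armCost c₀ c (none : Arm N K) = minCost (armCost c₀ c : Arm N K → ℝ) :=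
    (minCost_armCost hc).symm
  set L := A (parallelGraph N) (armCost c₀ c) (one_le_armCost h₀ hc)
  have hn0 : (0 : ℝ) ≤ (⌊B / c⌋₊ : ℝ) := Nat.cast_nonneg _
  set n : ℝ := (⌊B / c⌋₊ : ℝ) with hn
  set R : ℝ := √((K * N : ℝ) / n) with hRdef
  set δ : ℝ := R / 32 with hδdef
  have hR : 0 ≤ R := Real.sqrt_nonneg _
  have hδ : 0 ≤ δ := by positivity
  have hδR : δ ≤ R := by linarith
  have hnR : n * R = √(n * (K * N : ℝ)) := by
    -- For `n = 0` both sides vanish, by division by zero in `R`.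
    rcases hn0.eq_or_lt with h | h
    · rw [← h]; simp
    · rw [← Real.sqrt_sq hn0, hRdef, ← Real.sqrt_mul (sq_nonneg _), Real.sqrt_sq hn0]
      congr 1
      field_simp
  have hz' : ∀ i : Fin N, nullEffect δ (i, (0 : Fin K)) = 0 := by simp [nullEffect]
  have hop : ∀ (M : SCM (parallelGraph N) K) (q : Fin N × Fin K), M.mean none = 0 →
      0 ≤ M.mean (some q) → n * M.mean (some q) ≤ optimalReward M (armCost c₀ c) B :=
    fun M q h1 h2 => le_optimalReward M hcost hnone hB (b := some q) (by simp) h1 h2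
  rw [← hnR]
  -- The null mean is `-δ` rather than `0` so that many pulls are themselves costly. This makes the
  -- dichotomy work even with a single effective intervention (`N = 1`, `K = 2`), where averaging
  -- over interventions gains nothing.
  rcases le_or_gt (n / 2)
    (∑ p ∈ effective N K, expectedPulls (additiveSCM (nullEffect δ)) L {some p}) with h | h
  · refine ⟨additiveSCM (nullEffect δ), additiveSCM_gaussian hz' hR fun p => ?_, ?_⟩
    · unfold nullEffect
      split_ifs
      · simpa using hR
      · rwa [abs_neg, abs_of_nonneg hδ]
    -- `hop` concerns interventions only, so the zero-mean competitor is a `do(X_i = 0)` instead of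
    -- `a_0`; it shows that the optimum is nonnegative.
    · have h1 : (additiveSCM (nullEffect δ)).mean (some ((⟨0, hN⟩ : Fin N), (0 : Fin K))) = 0 := by
        rw [mean_additiveSCM hz']
        exact hz' _
      have h2 := hop (additiveSCM (nullEffect δ)) (⟨0, hN⟩, 0)
        (by rw [mean_additiveSCM hz']; rfl) h1.ge
      rw [h1, mul_zero] at h2
      unfold cumulativeRegret
      rw [expectedReward_nullEffect]
      have h3 := mul_le_mul_of_nonneg_left h hδ
      have h4 := mul_nonneg hn0 hR
      have h5 : δ * (n / 2) = n * R / 64 := by rw [hδdef]; ring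
      linarith
  · have hnpos : 0 < n := by
      have : 0 ≤ ∑ p ∈ effective N K, expectedPulls (additiveSCM (nullEffect δ)) L {some p} :=
        Finset.sum_nonneg fun p _ => expectedPulls_nonneg _ _ _
      linarith
    set m : ℝ := ((effective N K).card : ℝ) with hm
    -- `K ≤ 2 (K - 1)`, since `K ≥ 2`.
    have hmK : (K * N : ℝ) ≤ 2 * m := by
      rw [hm, card_effective]
      have : K * N ≤ 2 * (N * (K - 1)) := by
        obtain ⟨k, rfl⟩ : ∃ k, K = k + 2 := ⟨K - 2, by omega⟩
        simp only [Nat.add_succ_sub_one]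
        nlinarith [Nat.zero_le (N * k)]
      exact_mod_cast this
    have hKN : (1 : ℝ) ≤ N ∧ (2 : ℝ) ≤ K := ⟨by exact_mod_cast hN, by exact_mod_cast hK⟩
    have hm1 : 1 ≤ m := by nlinarith [hKN.1, hKN.2]
    obtain ⟨q, hq, hE⟩ : ∃ q ∈ effective N K,
        expectedPulls (additiveSCM (nullEffect δ)) L {some q} < n / (2 * m) := by
      refine Finset.exists_lt_of_sum_lt (lt_of_lt_of_eq h ?_)
      rw [Finset.sum_const, nsmul_eq_mul, ← hm]
      field_simp
    have hq2 := mem_effective.1 hq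
    have hz : ∀ i, flippedEffect δ q (i, 0) = 0 := by simp [flippedEffect]
    refine ⟨additiveSCM (flippedEffect δ q), additiveSCM_gaussian hz hR fun p => ?_, ?_⟩
    · unfold flippedEffect
      split_ifs
      · simpa using hR
      · rwa [abs_of_nonneg hδ]
      · rwa [abs_neg, abs_of_nonneg hδ]
    · have h1 : (additiveSCM (flippedEffect δ q)).mean (some q) = δ := by
        rw [mean_additiveSCM hz]
        simp [armMean, flippedEffect, hq2]
      have h2 := hop (additiveSCM (flippedEffect δ q)) q
        (by rw [mean_additiveSCM hz]; rfl) (h1.ge.trans' hδ)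
      rw [h1] at h2
      have h3 := expectedReward_flippedEffect_le hδ q L
      have h4 := expectedPulls_flippedEffect_le (δ := δ) hq2 hcost hB L
      change _ ≤ _ + n * _ at h4
      set E := expectedPulls (additiveSCM (nullEffect δ)) L {some q}
      have hE1 : E ≤ n / 2 := by
        refine hE.le.trans ?_
        gcongr
        linarith
      -- `δ² = KN / (1024 n)` and `E < n / (2 m)`, so `n` cancels and `KN ≤ 2 m` remains to be used.
      have hE2 : 16 * δ ^ 2 * E ≤ 1 / 32 := by
        have h5 : δ ^ 2 = (K * N : ℝ) / n / 1024 := by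
          rw [hδdef, div_pow, hRdef, Real.sq_sqrt (by positivity)]
          norm_num
        calc
          16 * δ ^ 2 * E ≤ 16 * δ ^ 2 * (n / (2 * m)) := by gcongr
          _ = (K * N : ℝ) / (2 * m) / 64 := by rw [h5]; field_simp; norm_num
          _ ≤ 1 / 64 := by
            gcongr
            exact div_le_one_of_le₀ hmK (by linarith)
          _ ≤ 1 / 32 := by norm_num
      -- `1/2 + 1/8 + 1/32 = 21/32 ≤ 3/4`.
      have h5 : expectedPulls (additiveSCM (flippedEffect δ q)) L {some q} ≤ 3 / 4 * n := by
        have := mul_le_mul_of_nonneg_left hE2 hn0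
        linarith
      have h6 := mul_le_mul_of_nonneg_left h5 hδ
      unfold cumulativeRegret
      have h7 : δ * n = n * R / 32 := by rw [hδdef]; ring
      linarith
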